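/- Let $p$ be a prime, let $q$ and $r>1$ be powers of $p$, and let $\mathbb{F}_q$ be the field with $q$ elements. Call a polynomial original if its value at $0$ is $0$, and write $g\circ h=g(h)$. For $\varepsilon\in\{0,1\}$, $u,s\in\mathbb{F}_q^\times$, a positive divisor $\ell$ of $r-1$, and $m=(r-1)/\ell$, put \[ T(\varepsilon,u)=\{t\in\mathbb{F}_q : t^{r+1}-\varepsilon u t+u=0\},\qquad F(\varepsilon,u,\ell,s)=x\,(x^{\ell(r+1)}-\varepsilon u s^{r}x^{\ell}+us^{r+1})^{m}, \] and for $t\in T(\varepsilon,u)$ (note $t\neq 0$) \[ G(u,\ell,s,t)=x\,(x^{\ell}-us^{r}t^{-1})^{m},\qquad H(\ell,s,t)=x\,(x^{\ell}-st)^{m}. \] For $w\in\mathbb{F}_q$, and with $f=F(\varepsilon,u,\ell,s)$, $g=G(u,\ell,s,t)$, $h=H(\ell,s,t)$, put \[ F(\varepsilon,u,\ell,s)_{(w)}=(x-f(w))\circ f\circ(x+w),\quad g_{(w)}=(x-f(w))\circ g\circ(x+h(w)),\quad h_{(w)}=(x-h(w))\circ h\circ(x+w). \] **Coincidences.** Let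 $\varepsilon,u,\ell,s,t$ and $\varepsilon^*,u^*,\ell^*,s^*,t^*$ be two sets of parameters as above, with $t\in T(\varepsilon,u)$ and $t^*\in T(\varepsilon^*,u^*)$, let $w,w^*\in\mathbb{F}_q$, and let $f=F(\varepsilon,u,\ell,s)_{(w)}$, $f^*=F(\varepsilon^*,u^*,\ell^*,s^*)_{(w^*)}$. 1. If $f=f^*$, then $\varepsilon=\varepsilon^*$ and $\ell=\ell^*$. 2. If $\varepsilon=0$ and $\ell=r-1$, then $f=F(0,-1,r-1,st)_{(0)}$, and $f=f^*$ if and only if $\varepsilon^*=\varepsilon$, $\ell^*=\ell$ and $(st/(s^*t^*))^{r+1}=1$. 3. If $\varepsilon=0$ and $\ell<r-1$, then $f=F(0,-1,\ell,st)_{(w)}$, and $f=f^*$ if and only if $\varepsilon^*=\varepsilon$, $\ell^*=\ell$, $w=w^*$ and $(st/(s^*t^*))^{r+1}=1$. 4. If $\varepsilon=1$ and $\ell=r-1$, then $f=F(1,u,r-1,s)_{(0)}$, and $f=f^*$ if and only if $\varepsilon^*=\varepsilon$, $\ell^*=\ell$, $u=u^*$ and $s=s^*$. 5. If $\varepsilon=1$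 and $\ell<r-1$, then $f=f^*$ if and only if $\varepsilon^*=\varepsilon$, $\ell^*=\ell$, $u=u^*$, $s=s^*$ and $w=w^*$. **Count.** An $i$-collision is a set of exactly $i$ pairs $(g,h)$ of monic original polynomials in $\mathbb{F}_q[x]$, all with the same composition $g\circ h$ and the same $\deg g$. Let $\mathbb{F}_q[x;r]$ be the set of $r$-additive polynomials $\sum_j a_jx^{r^j}$, and let $c_i^{(2)}$ be the number of pairs $(a,b)\in\mathbb{F}_q^2$ with $ab\ne0$ such that $x^{r^2}+ax^r+bx$ has a maximal $i$-collision in $\mathbb{F}_q[x;r]$ with $\deg g=r$, that is, an $i$-collision with composition $x^{r^2}+ax^r+bx$ and components in $\mathbb{F}_q[x;r]$ with $\deg g=r$ that is contained in no such $(i+1)$-collision. Let $\gamma=\gcd(r+1,q-1)$, let $i\in\{2,r+1\}$, and let $N_i$ be the number of $i$-collisions of the form $\{(g_{(w)},h_{(w)}) : t\in T(\varepsilon,u)\}$, where $\varepsilon,u,\ell,s$ range over all parameters as above and $w$ over $\mathbb{F}_q$. Then $N_i$ is finite and \[ N_i=\bigl(1-q+q\,d(r-1)\bigr)\Bigl(c_i^{(2)}+\delta_{\gamma,i}\,\frac{q-1}{\gamma}\Bigr),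 \] where $d(r-1)$ is the number of positive divisors of $r-1$ and $\delta$ is Kronecker's delta. -/

import Mathlib

open Polynomial

namespace CompositionCollision

variable {K : Type*} [Field K]

/-- Monic polynomials `f` that are original, that is, with `f(0) = 0`. -/
def MonicOriginal (f : K[X]) : Prop := f.Monic ∧ f.eval 0 = 0

/-- The set `K[x; r]` of `r`-additive polynomials `∑ aᵢ x ^ (r ^ i)`. -/
def additivePolys (K : Type*) [Field K] (r : ℕ) : Set K[X] :=
  {f | ∃ (n : ℕ) (a : ℕ → K), f = ∑ i ∈ Finset.range (n + 1), C (a i) * X ^ (r ^ i)}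

/-- `S` is an (equal-degree) `i`-collision of `f` with components in `R`: a set of exactly `i` pairs
`(g, h)` of monic original polynomials in `R` with `g ∘ h = f` and `deg g = k`. -/
def IsCollision (R : Set K[X]) (f : K[X]) (k i : ℕ) (S : Set (K[X] × K[X])) : Prop :=
  S.encard = i ∧ ∀ P ∈ S, P.1 ∈ R ∧ P.2 ∈ R ∧ MonicOriginal P.1 ∧ MonicOriginal P.2 ∧
    P.1.natDegree = k ∧ P.1.comp P.2 = f

/-- An `i`-collision that is not contained in an `(i + 1)`-collision. -/
def IsMaximalCollision (R : Set K[X]) (f : K[X]) (k i : ℕ) (S : Set (K[X] × K[X])) : Prop :=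
  IsCollision R f k i S ∧ ¬ ∃ S', IsCollision R f k (i + 1) S' ∧ S ⊆ S'

/-- The pairs `(a, b)` with `ab ≠ 0` for which the additive trinomial `x ^ (r ^ 2) + a x ^ r + b x`
has a maximal `i`-collision (with components of degree `r`) in `K[x; r]`. -/
def trinomialSet (K : Type*) [Field K] (r i : ℕ) : Set (K × K) :=
  {ab | ab.1 * ab.2 ≠ 0 ∧ ∃ S : Set (K[X] × K[X]),
    IsMaximalCollision (additivePolys K r) (X ^ r ^ 2 + C ab.1 * X ^ r + C ab.2 * X) r i S}

/-- The number `c_i^{(2)}` of these pairs. -/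
noncomputable def trinomialCount (K : Type*) [Field K] (r i : ℕ) : ℕ :=
  (trinomialSet K r i).ncard

/-- The conditions on the parameters `ε, u, ℓ, s`. -/
def Admissible (r : ℕ) (ε u : K) (ℓ : ℕ) (s : K) : Prop :=
  (ε = 0 ∨ ε = 1) ∧ u ≠ 0 ∧ s ≠ 0 ∧ 0 < ℓ ∧ ℓ ∣ r - 1

/-- The set `T` of roots in `K` of `t ^ (r + 1) - ε u t + u`. -/
def rootSetT (r : ℕ) (ε u : K) : Set K := {t | t ^ (r + 1) - ε * u * t + u = 0}

/-- `F(ε, u, ℓ, s)`, where the outer exponent is `m = (r - 1) / ℓ`. -/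
noncomputable def polyF (r : ℕ) (ε u : K) (ℓ : ℕ) (s : K) : K[X] :=
  X * (X ^ (ℓ * (r + 1)) - C (ε * u * s ^ r) * X ^ ℓ + C (u * s ^ (r + 1))) ^ ((r - 1) / ℓ)

/-- `G(u, ℓ, s, t)`. -/
noncomputable def polyG (r : ℕ) (u : K) (ℓ : ℕ) (s t : K) : K[X] :=
  X * (X ^ ℓ - C (u * s ^ r * t⁻¹)) ^ ((r - 1) / ℓ)

/-- `H(ℓ, s, t)`. -/
noncomputable def polyH (r ℓ : ℕ) (s t : K) : K[X] :=
  X * (X ^ ℓ - C (s * t)) ^ ((r - 1) / ℓ)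

/-- `F(ε, u, ℓ, s)_(w) = (x - f(w)) ∘ f ∘ (x + w)` for `f = F(ε, u, ℓ, s)`. -/
noncomputable def shiftF (r : ℕ) (ε u : K) (ℓ : ℕ) (s w : K) : K[X] :=
  (X - C ((polyF r ε u ℓ s).eval w)).comp ((polyF r ε u ℓ s).comp (X + C w))

/-- `g_(w) = (x - f(w)) ∘ g ∘ (x + h(w))` for `f = F(ε, u, ℓ, s)`, `g = G(u, ℓ, s, t)` and
`h = H(ℓ, s, t)`. -/
noncomputable def shiftG (r : ℕ) (ε u : K) (ℓ : ℕ) (s t w : K) : K[X] :=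
  (X - C ((polyF r ε u ℓ s).eval w)).comp
    ((polyG r u ℓ s t).comp (X + C ((polyH r ℓ s t).eval w)))

/-- `h_(w) = (x - h(w)) ∘ h ∘ (x + w)` for `h = H(ℓ, s, t)`. -/
noncomputable def shiftH (r ℓ : ℕ) (s t w : K) : K[X] :=
  (X - C ((polyH r ℓ s t).eval w)).comp ((polyH r ℓ s t).comp (X + C w))

/-- The set of pairs `{(g_(w), h_(w)) : t ∈ T}`. -/
noncomputable def constructedPairs (r : ℕ) (ε u : K) (ℓ : ℕ) (s w : K) : Set (K[X] × K[X]) :=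
  (fun t => (shiftG r ε u ℓ s t w, shiftH r ℓ s t w)) '' rootSetT r ε u

/-- The set of all `i`-collisions over `K` of the constructed form. -/
def constructedCollisions (K : Type*) [Field K] (r i : ℕ) : Set (Set (K[X] × K[X])) :=
  {S | (∃ (f : K[X]) (k : ℕ), IsCollision Set.univ f k i S) ∧
    ∃ (ε u : K) (ℓ : ℕ) (s w : K), Admissible r ε u ℓ s ∧ S = constructedPairs r ε u ℓ s w}

end CompositionCollision

/-! Put τ = st, A = εus^r, B = us^(r+1) and m = (r-1)/ℓ. Then F = x·S^m with S = x^(ℓ(r+1)) - Ax^ℓ +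
B, H = x(x^ℓ - τ)^m, G = x(x^ℓ - B/τ)^m, and t ∈ T becomes τ^(r+1) - Aτ + B = 0. As the r-th power
map is additive, every such τ gives G ∘ H = F (`outerPoly_comp`).

Since mℓ = r-1 = -1 in K, the derivative of F is B·S^(m-1). From it one reads off B, ℓ and, for m >
1, S itself, hence w and A. For m = 1 the polynomial is additive, so w has no effect. This is
`originalShift_outerPoly_injective`; the coincidences follow by solving for (ε, u, s).

For the count, i-collisions correspond to pairs (A, B) with exactly i roots τ, times normalized
pairs (ℓ, w). The pairs with A ≠ 0 are the trinomials counted by c_i^(2), because their additive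
decompositions are again given by the roots τ. For A = 0 one counts (r+1)-th roots in the cyclic
group of K. -/

namespace CompositionCollision

variable {K : Type*} [Field K]

/-- `x (x ^ (ℓ (r + 1)) - A x ^ ℓ + B) ^ ((r - 1) / ℓ)`. -/
noncomputable def outerPoly (r : ℕ) (A B : K) (ℓ : ℕ) : K[X] :=
  X * (X ^ (ℓ * (r + 1)) - C A * X ^ ℓ + C B) ^ ((r - 1) / ℓ)

/-- `x (x ^ ℓ - c) ^ ((r - 1) / ℓ)`. -/
noncomputable def innerPoly (r ℓ : ℕ) (c : K) : K[X] :=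
  X * (X ^ ℓ - C c) ^ ((r - 1) / ℓ)

/-- The original shift `f(x + w) - f(w)`. -/
noncomputable def originalShift (f : K[X]) (w : K) : K[X] := f.comp (X + C w) - C (f.eval w)

/-- The constant terms cancel because the outer factor is shifted by h(w); a decomposition of f thus
gives one of its shift. -/
theorem originalShift_comp (g h : K[X]) (w : K) :
    (originalShift g (h.eval w)).comp (originalShift h w) = originalShift (g.comp h) w := by
  simp [originalShift, comp_assoc, eval_comp]

theorem eval_zero_originalShift (f : K[X]) (w : K) : (originalShift f w).eval 0 = 0 := by
  simp [originalShift, eval_comp]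

theorem natDegree_originalShift (f : K[X]) (w : K) :
    (originalShift f w).natDegree = f.natDegree := by
  simp [originalShift, natDegree_comp]

theorem monic_originalShift {f : K[X]} (hf : f.Monic) (h : f.natDegree ≠ 0) (w : K) :
    (originalShift f w).Monic := by
  have h1 : (f.comp (X + C w)).Monic := hf.comp_X_add_C w
  refine h1.sub_of_left ?_
  refine degree_C_le.trans_lt ?_
  rw [← natDegree_pos_iff_degree_pos, natDegree_comp]
  simpa using Nat.pos_of_ne_zero h

theorem derivative_originalShift (f : K[X]) (w : K) :
    derivative (originalShift f w) = (derivative f).comp (X + C w) := by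
  simp [originalShift, derivative_comp]

/-! ### Derivatives of the normal forms. -/

/-- The source of the cancellations in the derivatives; it also shows that ℓ is invertible in K. -/
theorem cast_div_mul_cast {r ℓ : ℕ} (hr : 1 < r) (hr0 : (r : K) = 0) (hℓ : ℓ ∣ r - 1) :
    (((r - 1) / ℓ : ℕ) : K) * (ℓ : K) = -1 := by
  rw [← Nat.cast_mul, Nat.div_mul_cancel hℓ, Nat.cast_sub hr.le, hr0]
  simp

theorem div_pos_of_dvd_sub_one {r ℓ : ℕ} (hr : 1 < r) (hℓ : ℓ ∣ r - 1) : 0 < (r - 1) / ℓ :=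
  Nat.div_pos (Nat.le_of_dvd (by omega) hℓ) (Nat.pos_of_dvd_of_pos hℓ (by omega))

/-- The product rule gives S^(n-1)·(S + n·x·S'), and the hypothesis `h` makes the second factor
constant. -/
theorem derivative_X_mul_pow {S : K[X]} {B m : K} {n : ℕ} (hn : 0 < n) (hm : (n : K) = m)
    (h : S + C m * (X * derivative S) = C B) :
    derivative (X * S ^ n) = C B * S ^ (n - 1) := by
  obtain ⟨k, rfl⟩ : ∃ k, n = k + 1 := ⟨n - 1, by omega⟩
  rw [derivative_mul, derivative_X, derivative_pow, hm, ← h]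
  simp only [Nat.add_sub_cancel]
  ring

theorem X_mul_derivative_X_pow (n : ℕ) :
    (X : K[X]) * derivative (X ^ n) = C (n : K) * X ^ n := by
  cases n with
  | zero => simp
  | succ n => rw [derivative_X_pow, Nat.add_sub_cancel]; ring

theorem derivative_innerPoly {r ℓ : ℕ} (hr : 1 < r) (hr0 : (r : K) = 0) (hℓ : ℓ ∣ r - 1) (c : K) :
    derivative (innerPoly r ℓ c) = C (-c) * (X ^ ℓ - C c) ^ ((r - 1) / ℓ - 1) := by
  refine derivative_X_mul_pow (div_pos_of_dvd_sub_one hr hℓ) rfl ?_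
  rw [derivative_sub, derivative_C, sub_zero, X_mul_derivative_X_pow, ← mul_assoc, ← C_mul,
    cast_div_mul_cast hr hr0 hℓ, C_neg, C_neg, C_1]
  ring

theorem derivative_outerPoly {r ℓ : ℕ} (hr : 1 < r) (hr0 : (r : K) = 0) (hℓ : ℓ ∣ r - 1)
    (A B : K) :
    derivative (outerPoly r A B ℓ) =
      C B * (X ^ (ℓ * (r + 1)) - C A * X ^ ℓ + C B) ^ ((r - 1) / ℓ - 1) := by
  refine derivative_X_mul_pow (div_pos_of_dvd_sub_one hr hℓ) rfl ?_
  -- The exponents ℓ(r+1) and ℓ agree in K, so x·S' = ℓ(S - B).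
  have h1 : X * derivative (X ^ (ℓ * (r + 1)) - C A * X ^ ℓ + C B) =
      C (ℓ : K) * (X ^ (ℓ * (r + 1)) - C A * X ^ ℓ) := by
    rw [derivative_add, derivative_C, add_zero, derivative_sub, derivative_C_mul, mul_sub,
      X_mul_derivative_X_pow, mul_left_comm, X_mul_derivative_X_pow]
    push_cast [hr0]
    simp only [zero_add, mul_one]
    ring
  rw [h1, ← mul_assoc, ← C_mul, cast_div_mul_cast hr hr0 hℓ, C_neg, C_1]
  ring

theorem natDegree_outer_base {r ℓ : ℕ} (hr : 1 < r) (hℓ0 : 0 < ℓ) (A B : K) :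
    (X ^ (ℓ * (r + 1)) - C A * X ^ ℓ + C B : K[X]).natDegree = ℓ * (r + 1) ∧
    (X ^ (ℓ * (r + 1)) - C A * X ^ ℓ + C B : K[X]).Monic := by
  have hlt : ℓ < ℓ * (r + 1) := by nlinarith
  have h1 : (X ^ (ℓ * (r + 1)) - C A * X ^ ℓ + C B : K[X]) =
      X ^ (ℓ * (r + 1)) + (C B - C A * X ^ ℓ) := by ring
  have h2 : (C B - C A * X ^ ℓ : K[X]).degree < (ℓ * (r + 1) : ℕ) := by
    refine (degree_sub_le _ _).trans_lt (max_lt ?_ ?_)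
    · exact degree_C_le.trans_lt (by exact_mod_cast (by omega : 0 < ℓ * (r + 1)))
    · exact (degree_C_mul_X_pow_le _ _).trans_lt (by exact_mod_cast hlt)
  rw [h1]
  exact ⟨natDegree_eq_of_degree_eq_some (by
    rw [degree_add_eq_left_of_degree_lt (by rwa [degree_X_pow]), degree_X_pow]), monic_X_pow_add h2⟩

/-! ### Composition, degrees and the additive case ℓ = r-1. -/

theorem outerPoly_comp {r ℓ : ℕ} (hr : 1 < r) (hadd : ∀ a b : K[X], (a - b) ^ r = a ^ r - b ^ r)
    (hℓ : ℓ ∣ r - 1) {A B τ : K} (hτ : τ ≠ 0) (h : τ ^ (r + 1) - A * τ + B = 0) :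
    (innerPoly r ℓ (B / τ)).comp (innerPoly r ℓ τ) = outerPoly r A B ℓ := by
  have hA : A = τ ^ r + B / τ := by field_simp; linear_combination -h
  set m := (r - 1) / ℓ with hm
  have hmℓ : m * ℓ = r - 1 := Nat.div_mul_cancel hℓ
  -- With h the inner polynomial, the claim is (x^ℓ - τ)(h^ℓ - B/τ) = S. It rests on (x^ℓ -
  -- τ)^(mℓ+1) = (x^ℓ - τ)^r = x^(ℓr) - τ^r.
  have key : (X ^ ℓ - C τ) * ((X * (X ^ ℓ - C τ) ^ m) ^ ℓ - C (B / τ)) =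
      (X ^ (ℓ * (r + 1)) - C A * X ^ ℓ + C B : K[X]) := by
    have h2 : (X ^ ℓ - C τ : K[X]) * ((X ^ ℓ - C τ) ^ m) ^ ℓ = X ^ (ℓ * r) - C (τ ^ r) := by
      rw [← pow_mul, hmℓ, ← pow_succ', Nat.sub_add_cancel hr.le, hadd, ← pow_mul, C_pow]
    have h3 : C B = C (B / τ) * C τ := by rw [← C_mul, div_mul_cancel₀ _ hτ]
    rw [mul_pow, hA, C_add, h3]
    linear_combination X ^ ℓ * h2
  simp only [innerPoly, outerPoly, mul_comp, pow_comp, X_comp, sub_comp, C_comp, ← hm]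
  rw [← key, mul_pow _ _ m]
  ring

theorem innerPoly_natDegree_monic {r ℓ : ℕ} (hr : 1 < r) (hℓ : ℓ ∣ r - 1) (c : K) :
    (innerPoly r ℓ c).natDegree = r ∧ (innerPoly r ℓ c).Monic := by
  have h0 : 0 < ℓ := Nat.pos_of_dvd_of_pos hℓ (by omega)
  have h1 : (X ^ ℓ - C c : K[X]).Monic := monic_X_pow_sub_C c h0.ne'
  refine ⟨?_, monic_X.mul (h1.pow _)⟩
  rw [innerPoly, monic_X.natDegree_mul (h1.pow _), h1.natDegree_pow, natDegree_X_pow_sub_C,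
    Nat.div_mul_cancel hℓ, natDegree_X]
  omega

theorem innerPoly_sub_one {r : ℕ} (hr : 1 < r) (c : K) :
    innerPoly r (r - 1) c = X ^ r - C c * X := by
  rw [innerPoly, Nat.div_self (by omega), pow_one, mul_sub, ← pow_succ', Nat.sub_add_cancel hr.le]
  ring

theorem outerPoly_sub_one {r : ℕ} (hr : 1 < r) (A B : K) :
    outerPoly r A B (r - 1) = X ^ r ^ 2 - C A * X ^ r + C B * X := by
  obtain ⟨k, rfl⟩ : ∃ k, r = k + 1 := ⟨r - 1, by omega⟩
  rw [outerPoly, Nat.div_self (by omega), pow_one, Nat.add_sub_cancel]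
  ring

theorem originalShift_outerPoly_sub_one {r : ℕ} (hr : 1 < r)
    (hadd : ∀ a b : K[X], (a + b) ^ r = a ^ r + b ^ r) (A B w : K) :
    originalShift (outerPoly r A B (r - 1)) w = outerPoly r A B (r - 1) := by
  have h2 : ∀ a b : K[X], (a + b) ^ r ^ 2 = a ^ r ^ 2 + b ^ r ^ 2 := fun a b => by
    rw [sq, pow_mul, hadd, hadd, ← pow_mul, ← pow_mul]
  rw [outerPoly_sub_one hr]
  simp only [originalShift, add_comp, sub_comp, mul_comp, C_comp, X_pow_comp, X_comp, h2, hadd,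
    eval_add, eval_sub, eval_mul, eval_C, eval_pow, eval_X, C_add, C_sub, C_mul, C_pow]
  ring

theorem originalShift_innerPoly_sub_one {r : ℕ} (hr : 1 < r)
    (hadd : ∀ a b : K[X], (a + b) ^ r = a ^ r + b ^ r) (c w : K) :
    originalShift (innerPoly r (r - 1) c) w = innerPoly r (r - 1) c := by
  rw [innerPoly_sub_one hr]
  simp only [originalShift, sub_comp, mul_comp, C_comp, X_pow_comp, X_comp, hadd,
    eval_sub, eval_mul, eval_C, eval_pow, eval_X, C_sub, C_mul, C_pow]
  ring

/-! ### Recovering the parameters from a shifted polynomial. -/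

theorem originalShift_innerPoly_injective {r ℓ : ℕ} (hr : 1 < r) (hr0 : (r : K) = 0)
    (hℓ : ℓ ∣ r - 1) {w c c' : K}
    (h : originalShift (innerPoly r ℓ c) w = originalShift (innerPoly r ℓ c') w) : c = c' := by
  have h0 : 0 < ℓ := Nat.pos_of_dvd_of_pos hℓ (by omega)
  have hlead : ∀ a : K,
      (derivative (originalShift (innerPoly r ℓ a) w)).leadingCoeff = -a := fun a => by
    have h1 : (X ^ ℓ - C a : K[X]).Monic := monic_X_pow_sub_C a h0.ne'
    rw [derivative_originalShift, derivative_innerPoly hr hr0 hℓ, mul_comp, C_comp, pow_comp,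
      leadingCoeff_mul, ((h1.comp_X_add_C w).pow _).leadingCoeff, leadingCoeff_C, mul_one]
  exact neg_injective (by rw [← hlead, ← hlead, h])

theorem originalShift_outerPoly_injective {r ℓ ℓ' : ℕ} (hr : 1 < r) (hr0 : (r : K) = 0)
    (hadd : ∀ a b : K[X], (a + b) ^ r = a ^ r + b ^ r)
    (hℓ : ℓ ∣ r - 1) (hℓ' : ℓ' ∣ r - 1) {w w' A A' B B' : K} (hB : B ≠ 0) (hB' : B' ≠ 0)
    (h : originalShift (outerPoly r A B ℓ) w = originalShift (outerPoly r A' B' ℓ') w') :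
    ℓ = ℓ' ∧ A = A' ∧ B = B' ∧ (ℓ < r - 1 → w = w') := by
  have hd := congrArg derivative h
  have h0 : 0 < ℓ := Nat.pos_of_dvd_of_pos hℓ (by omega)
  have h0' : 0 < ℓ' := Nat.pos_of_dvd_of_pos hℓ' (by omega)
  rw [derivative_originalShift, derivative_originalShift, derivative_outerPoly hr hr0 hℓ,
    derivative_outerPoly hr hr0 hℓ', mul_comp, mul_comp, C_comp, C_comp, pow_comp, pow_comp] at hd
  obtain ⟨hS1, hS2⟩ := natDegree_outer_base hr h0 A B
  obtain ⟨hS1', hS2'⟩ := natDegree_outer_base hr h0' A' B'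
  set S := (X ^ (ℓ * (r + 1)) - C A * X ^ ℓ + C B : K[X]) with hS
  set S' := (X ^ (ℓ' * (r + 1)) - C A' * X ^ ℓ' + C B' : K[X]) with hS'
  have hm := hS2.comp_X_add_C w
  have hm' := hS2'.comp_X_add_C w'
  have hBB : B = B' := by
    have := congrArg leadingCoeff hd
    rwa [leadingCoeff_mul, leadingCoeff_mul, (hm.pow _).leadingCoeff, (hm'.pow _).leadingCoeff,
      leadingCoeff_C, leadingCoeff_C, mul_one, mul_one] at this
  -- The derivative has degree (m-1)ℓ(r+1) = (r-1-ℓ)(r+1).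
  have hℓℓ : ℓ = ℓ' := by
    have := congrArg natDegree hd
    rw [natDegree_C_mul hB, natDegree_C_mul hB', natDegree_pow, natDegree_pow, natDegree_comp,
      natDegree_comp, hS1, hS1', natDegree_X_add_C, natDegree_X_add_C, mul_one, mul_one,
      ← mul_assoc, ← mul_assoc] at this
    have h3 := Nat.eq_of_mul_eq_mul_right (by omega) this
    rw [Nat.sub_mul, Nat.sub_mul, Nat.div_mul_cancel hℓ, Nat.div_mul_cancel hℓ'] at h3
    have := Nat.le_of_dvd (by omega) hℓ
    have := Nat.le_of_dvd (by omega) hℓ'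
    omega
  subst hℓℓ hBB
  have hle := Nat.le_of_dvd (by omega) hℓ
  rcases hle.eq_or_lt with heq | hlt
  -- Here m = 1 and the derivative is the constant B, so A is read off from the polynomial itself,
  -- at 1.
  · subst heq
    rw [originalShift_outerPoly_sub_one hr hadd, originalShift_outerPoly_sub_one hr hadd,
      outerPoly_sub_one hr, outerPoly_sub_one hr] at h
    refine ⟨rfl, ?_, rfl, fun h => absurd h (lt_irrefl _)⟩
    have := congrArg (eval 1) h
    simpa using this
  · have hm1 : (r - 1) / ℓ - 1 ≠ 0 := by
      have : 1 < (r - 1) / ℓ := by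
        rw [Nat.lt_div_iff_mul_lt' hℓ]; omega
      omega
    -- Since m-1 > 0, monic polynomials with equal (m-1)-th powers divide each other and so
    -- coincide.
    have hcomp : S.comp (X + C w) = S'.comp (X + C w') := by
      have h1 := mul_left_cancel₀ (C_ne_zero.2 hB) hd
      exact eq_of_monic_of_associated hm hm' (associated_of_dvd_dvd
        ((UniqueFactorizationMonoid.pow_dvd_pow_iff_dvd hm1).1 h1.dvd) ((UniqueFactorizationMonoid.pow_dvd_pow_iff_dvd hm1).1 h1.symm.dvd))
    -- Only (x+w)^(ℓ(r+1)) reaches this second-highest degree, with coefficient ℓ(r+1)w = ℓw in K.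
    have hcoeff : ∀ A w : K, ((X ^ (ℓ * (r + 1)) - C A * X ^ ℓ + C B : K[X]).comp
        (X + C w)).coeff (ℓ * (r + 1) - 1) = w * (ℓ : K) := fun A w => by
      have h1 : ℓ < ℓ * (r + 1) - 1 := by
        have : ℓ * (r + 1) = ℓ * r + ℓ := by ring
        have : 1 * 2 ≤ ℓ * r := Nat.mul_le_mul h0 hr
        omega
      have h2 : ℓ * (r + 1) - (ℓ * (r + 1) - 1) = 1 := by omega
      have h3 : (ℓ * (r + 1)).choose (ℓ * (r + 1) - 1) = ℓ * (r + 1) := by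
        rw [← Nat.choose_symm (by omega), h2, Nat.choose_one_right]
      rw [add_comp, sub_comp, mul_comp, C_comp, C_comp, X_pow_comp, X_pow_comp, coeff_add,
        coeff_sub, coeff_C_mul, coeff_X_add_C_pow, coeff_X_add_C_pow, coeff_C,
        Nat.choose_eq_zero_of_lt h1, if_neg (by omega), h2, h3]
      push_cast [hr0]
      ring
    have hww : w = w' := by
      have h1 := congrArg (fun P => coeff P (ℓ * (r + 1) - 1)) hcomp
      simp only [hS, hS', hcoeff] at h1
      refine mul_right_cancel₀ (fun h2 => ?_) h1
      have h3 := cast_div_mul_cast (K := K) hr hr0 hℓ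
      rw [h2] at h3
      simp at h3
    subst hww
    refine ⟨rfl, ?_, rfl, fun _ => rfl⟩
    -- Evaluating at 1 - w evaluates the unshifted polynomials at 1, leaving 1 - A + B.
    have h1 := congrArg (fun P => eval (1 - w) P) hcomp
    simpa [hS, hS', eval_comp] using h1

/-! ### Collisions indexed by the roots τ, and the change of parameters τ = st. -/

/-- The roots in `K` of `τ ^ (r + 1) - A τ + B`. -/
def scaledRoots (r : ℕ) (A B : K) : Set K := {τ | τ ^ (r + 1) - A * τ + B = 0}

/-- The shifted components with parameter `τ` of `outerPoly r A B ℓ`. -/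
noncomputable def collisionPair (r ℓ : ℕ) (B w τ : K) : K[X] × K[X] :=
  (originalShift (innerPoly r ℓ (B / τ)) ((innerPoly r ℓ τ).eval w),
    originalShift (innerPoly r ℓ τ) w)

theorem ne_zero_of_mem_scaledRoots {r : ℕ} {A B τ : K} (hB : B ≠ 0)
    (hτ : τ ∈ scaledRoots r A B) : τ ≠ 0 := by
  rintro rfl
  simp [scaledRoots, hB] at hτ

theorem sub_pow_of_add_pow {R : Type*} [CommRing R] {r : ℕ}
    (hadd : ∀ a b : R, (a + b) ^ r = a ^ r + b ^ r) (a b : R) :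
    (a - b) ^ r = a ^ r - b ^ r := by
  rw [eq_sub_iff_add_eq, ← hadd, sub_add_cancel]

theorem collisionPair_comp {r ℓ : ℕ} (hr : 1 < r)
    (hadd : ∀ a b : K[X], (a + b) ^ r = a ^ r + b ^ r) (hℓ : ℓ ∣ r - 1) {A B τ : K} (w : K)
    (hB : B ≠ 0) (hτ : τ ∈ scaledRoots r A B) :
    (collisionPair r ℓ B w τ).1.comp (collisionPair r ℓ B w τ).2 =
      originalShift (outerPoly r A B ℓ) w := by
  rw [collisionPair, originalShift_comp, outerPoly_comp hr (sub_pow_of_add_pow hadd) hℓ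
    (ne_zero_of_mem_scaledRoots hB hτ) hτ]

theorem collisionPair_injective {r ℓ : ℕ} (hr : 1 < r) (hr0 : (r : K) = 0) (hℓ : ℓ ∣ r - 1)
    (B w : K) : Function.Injective (collisionPair r ℓ B w) := fun _ _ h =>
  originalShift_innerPoly_injective hr hr0 hℓ (congrArg Prod.snd h)

theorem monicOriginal_originalShift_innerPoly {r ℓ : ℕ} (hr : 1 < r) (hℓ : ℓ ∣ r - 1) (c w : K) :
    MonicOriginal (originalShift (innerPoly r ℓ c) w) := by
  obtain ⟨h1, h2⟩ := innerPoly_natDegree_monic hr hℓ c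
  exact ⟨monic_originalShift h2 (by omega) w, eval_zero_originalShift _ _⟩

theorem isCollision_image_collisionPair {r ℓ i : ℕ} (hr : 1 < r) (hr0 : (r : K) = 0)
    (hadd : ∀ a b : K[X], (a + b) ^ r = a ^ r + b ^ r) (hℓ : ℓ ∣ r - 1) {A B : K} (w : K)
    (hB : B ≠ 0) (hi : (scaledRoots r A B).encard = i) :
    IsCollision Set.univ (originalShift (outerPoly r A B ℓ) w) r i
      (collisionPair r ℓ B w '' scaledRoots r A B) := by
  refine ⟨by rw [(collisionPair_injective hr hr0 hℓ B w).encard_image, hi], ?_⟩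
  rintro _ ⟨τ, hτ, rfl⟩
  refine ⟨trivial, trivial, monicOriginal_originalShift_innerPoly hr hℓ _ _,
    monicOriginal_originalShift_innerPoly hr hℓ _ _, ?_, collisionPair_comp hr hadd hℓ w hB hτ⟩
  rw [collisionPair, natDegree_originalShift, (innerPoly_natDegree_monic hr hℓ _).1]

theorem shiftF_eq (r ℓ : ℕ) (ε u s w : K) : shiftF r ε u ℓ s w =
    originalShift (outerPoly r (ε * u * s ^ r) (u * s ^ (r + 1)) ℓ) w := by
  simp [shiftF, originalShift, polyF, outerPoly]

theorem mul_mem_scaledRoots_iff {r : ℕ} {ε u s t : K} (hs : s ≠ 0) :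
    s * t ∈ scaledRoots r (ε * u * s ^ r) (u * s ^ (r + 1)) ↔ t ∈ rootSetT r ε u := by
  have h : (s * t) ^ (r + 1) - ε * u * s ^ r * (s * t) + u * s ^ (r + 1) =
      s ^ (r + 1) * (t ^ (r + 1) - ε * u * t + u) := by ring
  simp only [scaledRoots, rootSetT, Set.mem_ofPred_eq]
  rw [h, mul_eq_zero, or_iff_right (pow_ne_zero _ hs)]

/-- `shiftG` subtracts f(w), whereas the original shift of g subtracts g(h(w)). They agree because f
= g ∘ h, which holds since t is a root. -/
theorem shiftG_shiftH_eq {r ℓ : ℕ} (hr : 1 < r)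
    (hadd : ∀ a b : K[X], (a + b) ^ r = a ^ r + b ^ r) {ε u s t : K} (w : K)
    (h : Admissible r ε u ℓ s) (ht : t ∈ rootSetT r ε u) :
    (shiftG r ε u ℓ s t w, shiftH r ℓ s t w) =
      collisionPair r ℓ (u * s ^ (r + 1)) w (s * t) := by
  obtain ⟨-, hu, hs, -, hℓ⟩ := h
  have hτ := (mul_mem_scaledRoots_iff hs).2 ht
  have h0 := ne_zero_of_mem_scaledRoots (mul_ne_zero hu (pow_ne_zero _ hs)) hτ
  have ht0 : t ≠ 0 := right_ne_zero_of_mul h0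
  have h1 : u * s ^ (r + 1) / (s * t) = u * s ^ r * t⁻¹ := by field_simp; ring
  have hc := outerPoly_comp hr (sub_pow_of_add_pow hadd) hℓ h0 hτ
  have hF : polyF r ε u ℓ s = (innerPoly r ℓ (u * s ^ (r + 1) / (s * t))).comp
    (innerPoly r ℓ (s * t)) := hc.symm
  have hG : polyG r u ℓ s t = innerPoly r ℓ (u * s ^ (r + 1) / (s * t)) := by
    rw [h1, innerPoly, polyG]
  have hH : polyH r ℓ s t = innerPoly r ℓ (s * t) := rfl
  simp [shiftG, shiftH, hG, hH, hF, collisionPair, originalShift, eval_comp]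

theorem constructedPairs_eq {r ℓ : ℕ} (hr : 1 < r)
    (hadd : ∀ a b : K[X], (a + b) ^ r = a ^ r + b ^ r) {ε u s : K} (w : K)
    (h : Admissible r ε u ℓ s) :
    constructedPairs r ε u ℓ s w = collisionPair r ℓ (u * s ^ (r + 1)) w ''
      scaledRoots r (ε * u * s ^ r) (u * s ^ (r + 1)) := by
  have hs := h.2.2.1
  ext P
  constructor
  · rintro ⟨t, ht, rfl⟩
    exact ⟨s * t, (mul_mem_scaledRoots_iff hs).2 ht, (shiftG_shiftH_eq hr hadd w h ht).symm⟩
  · rintro ⟨τ, hτ, rfl⟩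
    have h1 : s * (τ / s) = τ := mul_div_cancel₀ _ hs
    rw [← h1] at hτ
    have ht := (mul_mem_scaledRoots_iff hs).1 hτ
    refine ⟨τ / s, ht, ?_⟩
    rw [← h1]
    simpa only [h1] using shiftG_shiftH_eq hr hadd w h ht

/-! ### Parametrizing the constructed collisions. -/

/-- The pairs `(A, B)` with `B ≠ 0` for which `τ ^ (r + 1) - A τ + B` has `i` roots. -/
def rootCountSet (K : Type*) [Field K] (r i : ℕ) : Set (K × K) :=
  {P | P.2 ≠ 0 ∧ (scaledRoots r P.1 P.2).encard = i}

/-- The parameters `(ℓ, w)`, with `w` normalized to `0` for `ℓ = r - 1`. -/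
def shiftParams (K : Type*) [Field K] (r : ℕ) : Set (ℕ × K) :=
  {P | P.1 ∣ r - 1 ∧ (P.1 = r - 1 → P.2 = 0)}

theorem collisionPair_sub_one {r : ℕ} (hr : 1 < r)
    (hadd : ∀ a b : K[X], (a + b) ^ r = a ^ r + b ^ r) (B w τ : K) :
    collisionPair r (r - 1) B w τ = collisionPair r (r - 1) B 0 τ := by
  simp only [collisionPair, originalShift_innerPoly_sub_one hr hadd]

theorem constructedCollisions_eq_image {r i : ℕ} (hr : 1 < r) (hr0 : (r : K) = 0)
    (hadd : ∀ a b : K[X], (a + b) ^ r = a ^ r + b ^ r) :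
    constructedCollisions K r i =
      (fun P : (K × K) × (ℕ × K) =>
        collisionPair r P.2.1 P.1.2 P.2.2 '' scaledRoots r P.1.1 P.1.2) ''
      (rootCountSet K r i ×ˢ shiftParams K r) := by
  ext S
  constructor
  · rintro ⟨⟨f, k, hS⟩, ε, u, ℓ, s, w, h, rfl⟩
    have hB : u * s ^ (r + 1) ≠ 0 := mul_ne_zero h.2.1 (pow_ne_zero _ h.2.2.1)
    have hℓ := h.2.2.2.2
    rw [constructedPairs_eq hr hadd w h] at hS ⊢
    have hi := hS.1
    rw [(collisionPair_injective hr hr0 hℓ _ w).encard_image] at hi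
    refine ⟨((ε * u * s ^ r, u * s ^ (r + 1)), (ℓ, if ℓ = r - 1 then 0 else w)),
      ⟨⟨hB, hi⟩, hℓ, fun h => if_pos h⟩, ?_⟩
    dsimp only
    split_ifs with hl
    · subst hl
      exact Set.image_congr fun τ _ => (collisionPair_sub_one hr hadd _ w τ).symm
    · rfl
  · rintro ⟨⟨⟨A, B⟩, ℓ, w⟩, ⟨⟨hB, hi⟩, hℓ, -⟩, rfl⟩
    dsimp only at hB hi hℓ ⊢
    refine ⟨⟨_, _, isCollision_image_collisionPair hr hr0 hadd hℓ w hB hi⟩, ?_⟩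
    have h0 : 0 < ℓ := Nat.pos_of_dvd_of_pos hℓ (by omega)
    by_cases hA : A = 0
    -- For A = 0 the choice ε = 0, u = B, s = 1 realizes (A, B).
    · subst hA
      have h : Admissible r 0 B ℓ (1 : K) := ⟨Or.inl rfl, hB, one_ne_zero, h0, hℓ⟩
      refine ⟨0, B, ℓ, 1, w, h, ?_⟩
      rw [constructedPairs_eq hr hadd w h]
      simp
    -- For A ≠ 0, ε must be 1, and then B = As forces s = B/A and u = A/s^r.
    · have hs : B / A ≠ 0 := div_ne_zero hB hA
      have hsr := pow_ne_zero r hs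
      have h : Admissible r 1 (A / (B / A) ^ r) ℓ (B / A) :=
        ⟨Or.inr rfl, div_ne_zero hA hsr, hs, h0, hℓ⟩
      refine ⟨1, A / (B / A) ^ r, ℓ, B / A, w, h, ?_⟩
      have h1 : 1 * (A / (B / A) ^ r) * (B / A) ^ r = A := by
        rw [one_mul, div_mul_cancel₀ _ hsr]
      have h2 : A / (B / A) ^ r * (B / A) ^ (r + 1) = B := by
        rw [pow_succ, ← mul_assoc, div_mul_cancel₀ _ hsr, mul_div_cancel₀ _ hA]
      rw [constructedPairs_eq hr hadd w h, h1, h2]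

/-- One pair of the collision suffices: its composition is the shifted outer polynomial, which
determines all parameters. Such a pair exists because i ≠ 0. -/
theorem injOn_collision {r i : ℕ} (hr : 1 < r) (hr0 : (r : K) = 0)
    (hadd : ∀ a b : K[X], (a + b) ^ r = a ^ r + b ^ r) (hi0 : i ≠ 0) :
    Set.InjOn (fun P : (K × K) × (ℕ × K) =>
        collisionPair r P.2.1 P.1.2 P.2.2 '' scaledRoots r P.1.1 P.1.2)
      (rootCountSet K r i ×ˢ shiftParams K r) := by
  rintro ⟨⟨A, B⟩, ℓ, w⟩ ⟨⟨hB, hi⟩, hℓ, hw⟩ ⟨⟨A', B'⟩, ℓ', w'⟩ ⟨⟨hB', hi'⟩, hℓ', hw'⟩ h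
  dsimp only at hB hi hℓ hw hB' hi' hℓ' hw' h
  obtain ⟨τ, hτ⟩ : (scaledRoots r A B).Nonempty := by
    rw [← Set.encard_ne_zero, hi]
    exact_mod_cast hi0
  obtain ⟨τ', hτ', he⟩ : collisionPair r ℓ B w τ ∈ collisionPair r ℓ' B' w' ''
      scaledRoots r A' B' := h ▸ Set.mem_image_of_mem _ hτ
  have h1 := collisionPair_comp hr hadd hℓ w hB hτ
  rw [← he, collisionPair_comp hr hadd hℓ' w' hB' hτ'] at h1
  obtain ⟨rfl, rfl, rfl, hww⟩ :=
    originalShift_outerPoly_injective hr hr0 hadd hℓ' hℓ hB' hB h1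
  have : w = w' := by
    rcases (Nat.le_of_dvd (by omega) hℓ').eq_or_lt with heq | hlt
    · rw [hw heq, hw' heq]
    · exact (hww hlt).symm
  rw [this]

/-! ### Counting shift parameters and the case A = 0. -/

/-- The divisor r-1 contributes one pair and every other divisor contributes q. -/
theorem shiftParams_finite_ncard [Finite K] {r : ℕ} (hr : 1 < r) :
    (shiftParams K r).Finite ∧ ((shiftParams K r).ncard : ℚ) =
      1 - Nat.card K + Nat.card K * (Nat.divisors (r - 1)).card := by
  have hmem : r - 1 ∈ Nat.divisors (r - 1) := Nat.mem_divisors_self _ (by omega)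
  have h : shiftParams K r =
      insert (r - 1, (0 : K)) (((Nat.divisors (r - 1)).erase (r - 1) : Set ℕ) ×ˢ Set.univ) := by
    ext ⟨ℓ, w⟩
    have : r - 1 ≠ 0 := by omega
    simp only [shiftParams, Set.mem_ofPred_eq, Set.mem_insert_iff, Prod.mk.injEq, Set.mem_prod,
      Finset.mem_coe, Finset.mem_erase, Nat.mem_divisors, Set.mem_univ, and_true]
    by_cases hl : ℓ = r - 1 <;> simp [hl, this]
  have hfin : (((Nat.divisors (r - 1)).erase (r - 1) : Set ℕ) ×ˢ (Set.univ : Set K)).Finite :=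
    (Finset.finite_toSet _).prod Set.finite_univ
  refine ⟨h ▸ hfin.insert _, ?_⟩
  rw [h, Set.ncard_insert_of_notMem (by simp) hfin, Set.ncard_prod, Set.ncard_coe_finset,
    Finset.card_erase_of_mem hmem, Set.ncard_univ, Nat.cast_add, Nat.cast_mul,
    Nat.cast_sub (Finset.card_pos.2 ⟨_, hmem⟩)]
  push_cast
  ring

open Classical in
-- A nonempty fibre of the n-th power map is a coset of its kernel, which has order gcd(n, q-1) in
-- the cyclic group of units.
theorem encard_pow_eq [Finite K] {n : ℕ} (b : Kˣ) :
    {x : Kˣ | x ^ n = b}.encard =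
      if b ∈ (powMonoidHom n : Kˣ →* Kˣ).range then
        ((Nat.gcd n (Nat.card K - 1) : ℕ) : ℕ∞) else 0 := by
  split_ifs with h
  · obtain ⟨y, rfl⟩ := h
    have h1 : {x : Kˣ | x ^ n = powMonoidHom n y} =
        (fun z => y * z) '' ((powMonoidHom n : Kˣ →* Kˣ).ker : Set Kˣ) := by
      ext x
      constructor
      · intro hx
        refine ⟨y⁻¹ * x, ?_, mul_inv_cancel_left _ _⟩
        rw [SetLike.mem_coe, MonoidHom.mem_ker, map_mul, map_inv, powMonoidHom_apply n x, hx,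
          inv_mul_cancel]
      · rintro ⟨z, hz, rfl⟩
        rw [SetLike.mem_coe, MonoidHom.mem_ker, powMonoidHom_apply] at hz
        simp [mul_pow, hz]
    rw [h1, (mul_right_injective y).encard_image, ← (Set.toFinite _).cast_ncard_eq,
      ← Nat.card_coe_set_eq]
    have := IsCyclic.card_powMonoidHom_ker Kˣ n
    rw [Nat.card_units, Nat.gcd_comm] at this
    rw [← this]
    rfl
  · rw [Set.encard_eq_zero, Set.eq_empty_iff_forall_notMem]
    exact fun x hx => h ⟨x, hx⟩

open Classical in
-- As i ≠ 0, the values -B that count are exactly the n-th powers of units if i = gcd(n, q-1), and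
-- there are none otherwise.
theorem ncard_pow_add_eq_zero [Finite K] {n i : ℕ} (hn : n ≠ 0) (hi : i ≠ 0) :
    ({B : K | B ≠ 0 ∧ {τ : K | τ ^ n + B = 0}.encard = i}.ncard : ℚ) =
      if Nat.gcd n (Nat.card K - 1) = i then
        ((Nat.card K : ℚ) - 1) / (Nat.gcd n (Nat.card K - 1) : ℕ) else 0 := by
  have key : ∀ b : Kˣ, {τ : K | τ ^ n + -(b : K) = 0}.encard = {x : Kˣ | x ^ n = b}.encard := by
    intro b
    rw [← Units.val_injective.encard_image {x : Kˣ | x ^ n = b}]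
    congr 1
    ext τ
    constructor
    · intro h
      have h1 : τ ^ n = b := add_neg_eq_zero.1 h
      have h0 : τ ≠ 0 := by
        rintro rfl
        rw [zero_pow hn] at h1
        exact b.ne_zero h1.symm
      exact ⟨Units.mk0 τ h0, Units.ext (by simpa using h1), rfl⟩
    · rintro ⟨x, hx, rfl⟩
      have := congrArg (Units.val) (show x ^ n = b from hx)
      simp [← this]
  have hset : {B : K | B ≠ 0 ∧ {τ : K | τ ^ n + B = 0}.encard = i} =
      (fun b : Kˣ => -(b : K)) '' {b | {x : Kˣ | x ^ n = b}.encard = i} := by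
    ext B
    constructor
    · rintro ⟨hB, h⟩
      refine ⟨Units.mk0 (-B) (neg_ne_zero.2 hB), ?_, by simp⟩
      rw [Set.mem_ofPred_eq, ← key]
      simpa using h
    · rintro ⟨b, hb, rfl⟩
      exact ⟨neg_ne_zero.2 b.ne_zero, by rw [key]; exact hb⟩
  have hinj : Function.Injective (fun b : Kˣ => -(b : K)) :=
    neg_injective.comp Units.val_injective
  rw [hset, Set.ncard_image_of_injective _ hinj]
  simp only [encard_pow_eq]
  split_ifs with h
  · have h1 : {b : Kˣ | (if b ∈ (powMonoidHom n : Kˣ →* Kˣ).range then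
        ((Nat.gcd n (Nat.card K - 1) : ℕ) : ℕ∞) else 0) = i} =
        ((powMonoidHom n : Kˣ →* Kˣ).range : Set Kˣ) := by
      ext b
      rw [Set.mem_ofPred_eq, SetLike.mem_coe]
      split_ifs with hb
      · simp [hb, h]
      · simpa [hb, eq_comm] using hi
    rw [h1, ← Nat.card_coe_set_eq]
    have h2 := IsCyclic.card_powMonoidHom_range Kˣ n
    rw [Nat.card_units, Nat.gcd_comm] at h2
    have h3 : Nat.card ((powMonoidHom n : Kˣ →* Kˣ).range : Set Kˣ) = _ := h2
    rw [h3, Nat.cast_div (Nat.gcd_dvd_right _ _) (by rw [h]; exact_mod_cast hi),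
      Nat.cast_sub Nat.card_pos, Nat.cast_one]
  · rw [Nat.cast_eq_zero, Set.ncard_eq_zero (Set.toFinite _), Set.eq_empty_iff_forall_notMem]
    intro b hb
    rw [Set.mem_ofPred_eq] at hb
    split_ifs at hb
    · exact h (by exact_mod_cast hb)
    · exact hi (by exact_mod_cast hb.symm)

/-! ### Additive decompositions of trinomials. -/

theorem eq_of_mem_additivePolys {r : ℕ} (hr : 1 < r) {f : K[X]} (hf : f ∈ additivePolys K r)
    (hm : f.Monic) (hd : f.natDegree = r) : ∃ c, f = X ^ r - C c * X := by
  obtain ⟨n, a, ha⟩ := hf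
  have hco : ∀ k, (∀ i, k ≠ r ^ i) → f.coeff k = 0 := fun k hk => by
    rw [ha, finsetSum_coeff]
    exact Finset.sum_eq_zero fun i _ => by rw [coeff_C_mul_X_pow, if_neg (hk i)]
  refine ⟨-f.coeff 1, ?_⟩
  ext k
  rw [coeff_sub, coeff_X_pow, coeff_C_mul, coeff_X]
  rcases lt_trichotomy k r with h | h | h
  · by_cases h1 : k = 1
    · subst h1
      simp [h.ne]
    · rw [if_neg h.ne, if_neg (Ne.symm h1), hco k]
      · simp
      · rintro i rfl
        rcases i with _ | i
        · simp at h1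
        · exact absurd h (not_lt.2 (Nat.le_self_pow (by omega) r))
  · have : f.coeff r = 1 := by rw [← hd]; exact hm
    subst h
    simp [this, hr.ne]
  · rw [coeff_eq_zero_of_natDegree_lt (by omega), if_neg h.ne', if_neg (by omega)]
    simp

theorem mem_additivePolys_binomial (r : ℕ) (c : K) :
    (X ^ r - C c * X : K[X]) ∈ additivePolys K r :=
  ⟨1, fun i => if i = 0 then -c else 1, by simp [Finset.sum_range_succ]; ring⟩

/-- A collision missing some decomposition could be enlarged by it, so the only maximal collision is
the set `D` of all decompositions. -/
theorem isMaximalCollision_iff {R : Set K[X]} {f : K[X]} {k i : ℕ} {D : Set (K[X] × K[X])}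
    (hD : ∀ P, P ∈ D ↔ P.1 ∈ R ∧ P.2 ∈ R ∧ MonicOriginal P.1 ∧ MonicOriginal P.2 ∧
      P.1.natDegree = k ∧ P.1.comp P.2 = f) :
    (∃ S, IsMaximalCollision R f k i S) ↔ D.encard = i := by
  constructor
  · rintro ⟨S, ⟨hS, hP⟩, hmax⟩
    have hsub : S ⊆ D := fun P h => (hD P).2 (hP P h)
    suffices S = D by rw [← this, hS]
    refine hsub.antisymm fun P h => by_contra fun hn => hmax ⟨insert P S, ⟨?_, ?_⟩,
      Set.subset_insert _ _⟩
    · rw [Set.encard_insert_of_notMem hn, hS]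
      push_cast
      rfl
    · rintro Q (rfl | hQ)
      exacts [(hD _).1 h, hP Q hQ]
  · intro h
    refine ⟨D, ⟨h, fun P => (hD P).1⟩, ?_⟩
    rintro ⟨S, ⟨hS, hP⟩, -⟩
    have := Set.encard_le_encard (fun P h => (hD P).2 (hP P h) : S ⊆ D)
    rw [hS, h] at this
    have : i + 1 ≤ i := by exact_mod_cast this
    omega

/-- Additive components of degree r have the form x^r - cx and x^r - τx. Comparing coefficients
gives τ^r + c = A and cτ = B; eliminating c leaves the root equation for τ. -/
theorem additive_trinomial_decomposition {r : ℕ} (hr : 1 < r)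
    (hadd : ∀ a b : K[X], (a + b) ^ r = a ^ r + b ^ r) {A B : K} (hB : B ≠ 0)
    (P : K[X] × K[X]) :
    P ∈ collisionPair r (r - 1) B 0 '' scaledRoots r A B ↔
      P.1 ∈ additivePolys K r ∧ P.2 ∈ additivePolys K r ∧ MonicOriginal P.1 ∧
        MonicOriginal P.2 ∧ P.1.natDegree = r ∧
        P.1.comp P.2 = X ^ r ^ 2 - C A * X ^ r + C B * X := by
  have hpair : ∀ τ : K, collisionPair r (r - 1) B 0 τ =
      (X ^ r - C (B / τ) * X, X ^ r - C τ * X) := fun τ => by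
    rw [collisionPair, originalShift_innerPoly_sub_one hr hadd,
      originalShift_innerPoly_sub_one hr hadd, innerPoly_sub_one hr, innerPoly_sub_one hr]
  have hdeg : ∀ c : K, (X ^ r - C c * X : K[X]).natDegree = r := fun c => by
    rw [← innerPoly_sub_one hr, (innerPoly_natDegree_monic hr dvd_rfl c).1]
  have hmo : ∀ c : K, MonicOriginal (X ^ r - C c * X : K[X]) := fun c => by
    rw [← innerPoly_sub_one hr, ← originalShift_innerPoly_sub_one hr hadd c 0]
    exact monicOriginal_originalShift_innerPoly hr dvd_rfl c 0
  constructor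
  · rintro ⟨τ, hτ, rfl⟩
    have hc := collisionPair_comp hr hadd dvd_rfl 0 hB hτ
    rw [originalShift_outerPoly_sub_one hr hadd, outerPoly_sub_one hr] at hc
    refine ⟨?_, ?_, ?_, ?_, ?_, hc⟩ <;> rw [hpair]
    exacts [mem_additivePolys_binomial r _, mem_additivePolys_binomial r _, hmo _, hmo _, hdeg _]
  · obtain ⟨g, h⟩ := P
    rintro ⟨hg, hh, hgm, hhm, hgd, hc⟩
    dsimp only at hg hh hgm hhm hgd hc
    have hout : (X ^ r ^ 2 - C A * X ^ r + C B * X : K[X]).natDegree = r * r := by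
      rw [← outerPoly_sub_one hr, outerPoly]
      obtain ⟨h1, h2⟩ := natDegree_outer_base (K := K) hr (ℓ := r - 1) (by omega) A B
      rw [monic_X.natDegree_mul (h2.pow _), h2.natDegree_pow, h1, Nat.div_self (by omega),
        natDegree_X]
      obtain ⟨k, rfl⟩ : ∃ k, r = k + 1 := ⟨r - 1, by omega⟩
      rw [Nat.add_sub_cancel]
      ring
    have hhd : h.natDegree = r := by
      have h1 := congrArg natDegree hc
      rw [natDegree_comp, hgd, hout] at h1
      exact Nat.eq_of_mul_eq_mul_left (by omega) h1
    obtain ⟨c, rfl⟩ := eq_of_mem_additivePolys hr hg hgm.1 hgd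
    obtain ⟨τ, rfl⟩ := eq_of_mem_additivePolys hr hh hhm.1 hhd
    have hexp : (X ^ r - C c * X : K[X]).comp (X ^ r - C τ * X) =
        X ^ r ^ 2 - C (τ ^ r + c) * X ^ r + C (c * τ) * X := by
      rw [sub_comp, mul_comp, C_comp, X_pow_comp, X_comp, sub_pow_of_add_pow hadd, mul_pow,
        ← pow_mul, ← sq, C_add, C_mul, C_pow]
      ring
    rw [hexp] at hc
    have hcB : c * τ = B := by
      have := congrArg (fun f => coeff f 1) hc
      simpa [coeff_X_pow, coeff_X, hr.ne, (Nat.one_lt_pow two_ne_zero hr).ne,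
        -map_add, -map_mul] using this
    have hcA : τ ^ r + c = A := by
      rw [hcB] at hc
      have := congrArg (eval 1) hc
      simpa using this
    have hτ : τ ≠ 0 := by
      rintro rfl
      exact hB (by rw [← hcB, mul_zero])
    refine ⟨τ, ?_, ?_⟩
    · simp only [scaledRoots, Set.mem_ofPred_eq]
      rw [← hcA, ← hcB]
      ring
    · rw [hpair, ← hcB, mul_div_cancel_right₀ _ hτ]

/-- The sign arises because the trinomial carries +a·x^r and the normal form -A·x^r. -/
theorem mem_trinomialSet_iff {r i : ℕ} (hr : 1 < r) (hr0 : (r : K) = 0)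
    (hadd : ∀ a b : K[X], (a + b) ^ r = a ^ r + b ^ r) (a b : K) :
    (a, b) ∈ trinomialSet K r i ↔ a ≠ 0 ∧ (-a, b) ∈ rootCountSet K r i := by
  simp only [trinomialSet, rootCountSet, Set.mem_ofPred_eq, mul_ne_zero_iff, and_assoc]
  refine and_congr_right fun _ => and_congr_right fun hb => ?_
  have h := isMaximalCollision_iff (i := i)
    (additive_trinomial_decomposition hr hadd (A := -a) hb)
  rw [(collisionPair_injective hr hr0 dvd_rfl b 0).encard_image] at h
  rw [← h]
  simp

/-! ### Assembling the count. -/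

theorem ncard_rootCountSet [Finite K] {r i : ℕ} (hr : 1 < r) (hr0 : (r : K) = 0)
    (hadd : ∀ a b : K[X], (a + b) ^ r = a ^ r + b ^ r) (hi : i ≠ 0) :
    ((rootCountSet K r i).ncard : ℚ) = trinomialCount K r i +
      if Nat.gcd (r + 1) (Nat.card K - 1) = i then
        ((Nat.card K : ℚ) - 1) / (Nat.gcd (r + 1) (Nat.card K - 1) : ℕ) else 0 := by
  -- The split is into A ≠ 0, given by trinomials, and A = 0, given by pure (r+1)-th roots.
  have h1 : rootCountSet K r i = (fun P : K × K => (-P.1, P.2)) '' trinomialSet K r i ∪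
      Prod.mk 0 '' {B : K | B ≠ 0 ∧ {τ : K | τ ^ (r + 1) + B = 0}.encard = i} := by
    have h0 : ∀ B : K, ((0, B) ∈ rootCountSet K r i ↔
        B ≠ 0 ∧ {τ : K | τ ^ (r + 1) + B = 0}.encard = i) := fun B => by
      simp [rootCountSet, scaledRoots]
    ext ⟨A, B⟩
    constructor
    · intro h
      by_cases hA : A = 0
      · subst hA
        exact Or.inr ⟨B, (h0 B).1 h, rfl⟩
      · refine Or.inl ⟨(-A, B), ?_, by simp⟩
        rw [mem_trinomialSet_iff hr hr0 hadd]
        simpa [hA] using h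
    · rintro (⟨⟨a, b⟩, h, he⟩ | ⟨b, h, he⟩)
      · rw [mem_trinomialSet_iff hr hr0 hadd] at h
        rw [← he]
        exact h.2
      · rw [← he]
        exact (h0 b).2 h
  have hdisj : Disjoint ((fun P : K × K => (-P.1, P.2)) '' trinomialSet K r i)
      (Prod.mk 0 '' {B : K | B ≠ 0 ∧ {τ : K | τ ^ (r + 1) + B = 0}.encard = i}) := by
    rw [Set.disjoint_left]
    rintro _ ⟨⟨a, b⟩, h, rfl⟩ ⟨b', -, he⟩
    rw [mem_trinomialSet_iff hr hr0 hadd] at h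
    exact h.1 (neg_eq_zero.1 (congrArg Prod.fst he).symm)
  have hinj : Function.Injective (fun P : K × K => (-P.1, P.2)) := by
    rintro ⟨a, b⟩ ⟨c, d⟩ h
    simpa using h
  rw [h1, Set.ncard_union_eq hdisj (Set.toFinite _) (Set.toFinite _),
    Set.ncard_image_of_injective _ hinj, Set.ncard_image_of_injective _ (Prod.mk_right_injective 0),
    Nat.cast_add, ncard_pow_add_eq_zero (Nat.succ_ne_zero r) hi, trinomialCount]

theorem constructedCollisions_finite_ncard [Finite K] {r i : ℕ} (hr : 1 < r) (hr0 : (r : K) = 0)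
    (hadd : ∀ a b : K[X], (a + b) ^ r = a ^ r + b ^ r) (hi : i ≠ 0) :
    (constructedCollisions K r i).Finite ∧ ((constructedCollisions K r i).ncard : ℚ) =
      (1 - Nat.card K + Nat.card K * (Nat.divisors (r - 1)).card) *
        (trinomialCount K r i + if Nat.gcd (r + 1) (Nat.card K - 1) = i then
          ((Nat.card K : ℚ) - 1) / (Nat.gcd (r + 1) (Nat.card K - 1) : ℕ) else 0) := by
  obtain ⟨hfin, hcard⟩ := shiftParams_finite_ncard (K := K) hr
  rw [constructedCollisions_eq_image hr hr0 hadd]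
  refine ⟨((Set.toFinite _).prod hfin).image _, ?_⟩
  rw [(injOn_collision hr hr0 hadd hi).ncard_image, Set.ncard_prod, Nat.cast_mul, hcard,
    ncard_rootCountSet hr hr0 hadd hi, mul_comm]

/-! ### Coincidences and the main theorem. -/

/-- Equality means equal A, B and ℓ, and equal w if ℓ < r-1. Moreover ε = 0 exactly when A = 0, and
for ε = 1 the relation B = As recovers s and then u. -/
theorem shiftF_eq_iff {r ℓ ℓ' : ℕ} (hr : 1 < r) (hr0 : (r : K) = 0)
    (hadd : ∀ a b : K[X], (a + b) ^ r = a ^ r + b ^ r) {ε u s w ε' u' s' w' : K}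
    (h : Admissible r ε u ℓ s) (h' : Admissible r ε' u' ℓ' s') :
    shiftF r ε u ℓ s w = shiftF r ε' u' ℓ' s' w' ↔ ε = ε' ∧ ℓ = ℓ' ∧
      u * s ^ (r + 1) = u' * s' ^ (r + 1) ∧ (ε = 1 → u = u' ∧ s = s') ∧
      (ℓ < r - 1 → w = w') := by
  obtain ⟨hε, hu, hs, hℓ0, hℓ⟩ := h
  obtain ⟨hε', hu', hs', hℓ0', hℓ'⟩ := h'
  rw [shiftF_eq, shiftF_eq]
  constructor
  · intro h
    obtain ⟨hl, hA, hB, hw⟩ := originalShift_outerPoly_injective hr hr0 hadd hℓ hℓ'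
      (mul_ne_zero hu (pow_ne_zero _ hs)) (mul_ne_zero hu' (pow_ne_zero _ hs')) h
    have hsr := pow_ne_zero r hs
    have hsr' := pow_ne_zero r hs'
    have hεε : ε = ε' := by
      rcases hε with rfl | rfl <;> rcases hε' with rfl | rfl <;> simp_all
    refine ⟨hεε, hl, hB, ?_, hw⟩
    rintro rfl
    subst hεε
    rw [one_mul, one_mul] at hA
    have hss : s = s' := by
      rw [pow_succ, pow_succ, ← mul_assoc, ← mul_assoc, hA] at hB
      exact mul_left_cancel₀ (mul_ne_zero hu' hsr') hB
    subst hss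
    exact ⟨mul_right_cancel₀ hsr hA, rfl⟩
  · rintro ⟨rfl, rfl, hB, hus, hw⟩
    have hA : ε * u * s ^ r = ε * u' * s' ^ r := by
      rcases hε with rfl | rfl
      · simp
      · obtain ⟨rfl, rfl⟩ := hus rfl
        rfl
    rw [hA, hB]
    rcases (Nat.le_of_dvd (by omega) hℓ).eq_or_lt with rfl | hlt
    · rw [originalShift_outerPoly_sub_one hr hadd, originalShift_outerPoly_sub_one hr hadd]
    · rw [hw hlt]

end CompositionCollision

open CompositionCollision

theorem mainTheorem12 (p : ℕ) [Fact p.Prime] (K : Type*) [Field K] [Finite K] [CharP K p]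
    (e r : ℕ) (he : 0 < e) (hr : r = p ^ e) :
    (∀ (ε u : K) (ℓ : ℕ) (s t w ε' u' : K) (ℓ' : ℕ) (s' t' w' : K) (f f' : K[X]),
      CompositionCollision.Admissible r ε u ℓ s →
      t ∈ CompositionCollision.rootSetT r ε u →
      CompositionCollision.Admissible r ε' u' ℓ' s' →
      t' ∈ CompositionCollision.rootSetT r ε' u' →
      f = CompositionCollision.shiftF r ε u ℓ s w →
      f' = CompositionCollision.shiftF r ε' u' ℓ' s' w' →
      (f = f' → ε = ε' ∧ ℓ = ℓ') ∧
      (ε = 0 → ℓ = r - 1 →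
        f = CompositionCollision.shiftF r 0 (-1) (r - 1) (s * t) 0 ∧
        (f = f' ↔ ε' = ε ∧ ℓ' = ℓ ∧ (s * t / (s' * t')) ^ (r + 1) = 1)) ∧
      (ε = 0 → ℓ < r - 1 →
        f = CompositionCollision.shiftF r 0 (-1) ℓ (s * t) w ∧
        (f = f' ↔ ε' = ε ∧ ℓ' = ℓ ∧ w = w' ∧ (s * t / (s' * t')) ^ (r + 1) = 1)) ∧
      (ε = 1 → ℓ = r - 1 →
        f = CompositionCollision.shiftF r 1 u (r - 1) s 0 ∧
        (f = f' ↔ ε' = ε ∧ ℓ' = ℓ ∧ u = u' ∧ s = s')) ∧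
      (ε = 1 → ℓ < r - 1 →
        (f = f' ↔ ε' = ε ∧ ℓ' = ℓ ∧ u = u' ∧ s = s' ∧ w = w'))) ∧
    (∀ (q γ i : ℕ), q = Nat.card K → γ = Nat.gcd (r + 1) (q - 1) → (i = 2 ∨ i = r + 1) →
      (CompositionCollision.constructedCollisions K r i).Finite ∧
      ((CompositionCollision.constructedCollisions K r i).ncard : ℚ) =
        (1 - (q : ℚ) + (q : ℚ) * ((Nat.divisors (r - 1)).card : ℚ)) *
          ((CompositionCollision.trinomialCount K r i : ℚ) +
            (if γ = i then ((q : ℚ) - 1) / (γ : ℚ) else 0))) := by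
  have hr1 : 1 < r := hr ▸ Nat.one_lt_pow he.ne' (Fact.out : p.Prime).one_lt
  have hr0 : (r : K) = 0 := by
    rw [hr, Nat.cast_pow, CharP.cast_eq_zero, zero_pow he.ne']
  have hadd : ∀ a b : K[X], (a + b) ^ r = a ^ r + b ^ r := fun a b => by
    rw [hr, add_pow_char_pow]
  refine ⟨?_, ?_⟩
  · rintro ε u ℓ s t w ε' u' ℓ' s' t' w' f f' h ht h' ht' rfl rfl
    have key := fun w w' => shiftF_eq_iff (w := w) (w' := w') hr1 hr0 hadd h h'
    -- For ε = 0 the root equation reads t^(r+1) = -u, so B = -(st)^(r+1). This explains both the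
    -- representative with u = -1 and the criterion on (r+1)-th powers.
    have hpow : ∀ {u s t : K}, t ∈ rootSetT r 0 u → -1 * (s * t) ^ (r + 1) = u * s ^ (r + 1) := by
      intro u s t ht
      have h1 : t ^ (r + 1) - 0 * u * t + u = 0 := ht
      rw [mul_pow]
      linear_combination (-s ^ (r + 1)) * h1
    have hst : ε = 0 → s * t ≠ 0 := by
      rintro rfl h0
      have := hpow (s := s) ht
      rw [h0, zero_pow (Nat.succ_ne_zero r), mul_zero] at this
      exact mul_ne_zero h.2.1 (pow_ne_zero _ h.2.2.1) this.symm
    have hst' : ε' = 0 → s' * t' ≠ 0 := by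
      rintro rfl h0
      have := hpow (s := s') ht'
      rw [h0, zero_pow (Nat.succ_ne_zero r), mul_zero] at this
      exact mul_ne_zero h'.2.1 (pow_ne_zero _ h'.2.2.1) this.symm
    have hdiv : ε = 0 → ε' = 0 → ((s * t / (s' * t')) ^ (r + 1) = 1 ↔
        u * s ^ (r + 1) = u' * s' ^ (r + 1)) := by
      rintro rfl rfl
      rw [div_pow, div_eq_one_iff_eq (pow_ne_zero _ (hst' rfl)), ← hpow ht, ← hpow ht',
        neg_one_mul, neg_one_mul, neg_inj]
    have hnorm : ε = 0 → ∀ w₁, (ℓ < r - 1 → w = w₁) →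
        shiftF r ε u ℓ s w = shiftF r 0 (-1) ℓ (s * t) w₁ := by
      rintro rfl w₁ hw
      exact (shiftF_eq_iff hr1 hr0 hadd h ⟨Or.inl rfl, neg_ne_zero.2 one_ne_zero, hst rfl,
        h.2.2.2.1, h.2.2.2.2⟩).2 ⟨rfl, rfl, (hpow ht).symm, fun h => absurd h zero_ne_one, hw⟩
    refine ⟨fun hf => ?_, fun hε hℓ => ⟨?_, ?_⟩, fun hε hℓ => ⟨?_, ?_⟩, fun hε hℓ => ⟨?_, ?_⟩,
      fun hε hℓ => ?_⟩
    · obtain ⟨h1, h2, -⟩ := (key w w').1 hf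
      exact ⟨h1, h2⟩
    · rw [← hℓ]
      exact hnorm hε 0 fun h => absurd h (by omega)
    · rw [key]
      constructor
      · rintro ⟨h1, h2, h3, -⟩
        exact ⟨h1.symm, h2.symm, (hdiv hε (h1 ▸ hε)).2 h3⟩
      · rintro ⟨h1, h2, h3⟩
        exact ⟨h1.symm, h2.symm, (hdiv hε (h1.trans hε)).1 h3,
          fun h => absurd (hε.symm.trans h) zero_ne_one, fun h => absurd h (by omega)⟩
    · exact hnorm hε w fun _ => rfl
    · rw [key]
      constructor
      · rintro ⟨h1, h2, h3, -, h5⟩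
        exact ⟨h1.symm, h2.symm, h5 hℓ, (hdiv hε (h1 ▸ hε)).2 h3⟩
      · rintro ⟨h1, h2, h3, h4⟩
        exact ⟨h1.symm, h2.symm, (hdiv hε (h1.trans hε)).1 h4,
          fun h => absurd (hε.symm.trans h) zero_ne_one, fun _ => h3⟩
    · subst hε hℓ
      exact (shiftF_eq_iff hr1 hr0 hadd h h).2
        ⟨rfl, rfl, rfl, fun _ => ⟨rfl, rfl⟩, fun h => absurd h (lt_irrefl _)⟩
    · rw [key]
      constructor
      · rintro ⟨h1, h2, -, h4, -⟩
        exact ⟨h1.symm, h2.symm, h4 hε⟩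
      · rintro ⟨h1, h2, rfl, rfl⟩
        exact ⟨h1.symm, h2.symm, rfl, fun _ => ⟨rfl, rfl⟩, fun h => absurd h (by omega)⟩
    · rw [key]
      constructor
      · rintro ⟨h1, h2, -, h4, h5⟩
        exact ⟨h1.symm, h2.symm, (h4 hε).1, (h4 hε).2, h5 hℓ⟩
      · rintro ⟨h1, h2, rfl, rfl, h5⟩
        exact ⟨h1.symm, h2.symm, rfl, fun _ => ⟨rfl, rfl⟩, fun _ => h5⟩
  · rintro q γ i rfl rfl hi
    exact constructedCollisions_finite_ncard hr1 hr0 hadd (by omega)
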